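/- Let $m,n\ge 1$ and $l\ge 0$ be integers, and let $a_1,\dots,a_m$ and $b_1,\dots,b_n$ be real numbers with $a_ib_j\ge 0$ for all $i,j$ and $|a_i|<1$ for all $i$. Let $X=[x_{i,j}]_{1\le i\le m,\,1\le j\le n}$ be an array of independent random variables with $$\Pr(x_{i,j}=k)=\frac{(a_ib_j)^k}{1+a_ib_j},\qquad k\in\{0,1\},$$ the rows $i$ being numbered from bottom to top. An up/right-diagonal path from the bottom row to the top row meets every row in exactly one entry, each next entry lying to the north or to the north-east of the previous one; that is, it visits the entries $(1,j_1),(2,j_2),\dots,(m,j_m)$ for some $1\le j_1\le j_2\le\dots\le j_m\le n$. Let $$L^{01}_{m,n}:=\max_{1\le j_1\le\dots\le j_m\le n}\ \sum_{i=1}^m x_{i,j_i}$$ be the corresponding last passage time. Then $$\Pr(L^{01}_{m,n}\le l)=\prod_{i=1}^m\prod_{j=1}^n(1+a_ib_j)^{-1}\,\Big\langle\Big(\prod_{j=1}^n\prod_{k=1}^l(1+b_je^{\mathrm i\theta_k})\Big)\Big(\prod_{j=1}^m\prod_{k=1}^l(1-a_je^{-\mathrm i\theta_k})\Big)^{-1}\Big\rangle_{\mathrm{CUE}_l},$$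 where $\langle\,\cdot\,\rangle_{\mathrm{CUE}_l}$ denotes the average over $(\theta_1,\dots,\theta_l)\in[0,2\pi)^l$ with respect to the eigenvalue probability density of Haar distributed matrices in $U(l)$, $$\frac{1}{(2\pi)^l\,l!}\prod_{1\le j<k\le l}\big|e^{\mathrm i\theta_k}-e^{\mathrm i\theta_j}\big|^2$$ (for $l=0$ the average equals $1$). -/

import Mathlib

/-- The last passage time of an `m × n` array `x` (row `i` counted from the bottom, column `j`
from the left). A bottom-to-top up/right-diagonal path visits one entry in every row, each next
entry lying to the north or to the north-east of the previous one; it is given by the weakly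
increasing function `c` sending a row to the column in which the path meets that row.
The time is the maximum over all such paths of the sum of the entries visited. -/
def lastPassageTime {m n : ℕ} (x : Fin m → Fin n → ℕ) : ℕ :=
  (Finset.univ.filter fun c : Fin m → Fin n => ∀ i i' : Fin m, i ≤ i' → c i ≤ c i').sup
    fun c => ∑ i, x i (c i)

/-- The eigenvalue probability density function of Haar distributed matrices in `U(l)`. -/
noncomputable def cueDensity (l : ℕ) (θ : Fin l → ℝ) : ℝ :=
  1 / ((2 * Real.pi) ^ l * (l.factorial : ℝ)) *
    ∏ j : Fin l, ∏ k ∈ Finset.Ioi j,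
      ‖Complex.exp (Complex.I * (θ k : ℂ)) - Complex.exp (Complex.I * (θ j : ℂ))‖ ^ 2

/-- The average of a function of the eigenvalue angles in `[0, 2π)` with respect to the
eigenvalue probability density function of `U(l)`. -/
noncomputable def cueAverage (l : ℕ) (f : (Fin l → ℝ) → ℂ) : ℂ :=
  ∫ θ in Set.univ.pi fun _ : Fin l => Set.Ico (0 : ℝ) (2 * Real.pi),
    (cueDensity l θ : ℂ) * f θ

/-!
The bound `lastPassageTime x ≤ l` says that paths staying in the first `c k` columns have passage
time at most `k`, where `c k = 0` for `k < l` and `c k = n` otherwise. Conditions of this kind are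
stable under removal of the top row: an entry `1` of that row in column `j` with
`c k ≤ j < c (k + 1)` forces the paths below it that end at or before `j` to have passage time at
most `k`, so it raises the `k`-th threshold above `j`.

Attach to the thresholds `c` the determinant whose `k`-th column consists of Fourier coefficients of
`∏_{j ≥ c k} (1 + b j * z) * ∏_{i < m} (1 - a i / z)⁻¹`. The top rows split into independent blocks
`c k ≤ j < c (k + 1)`, so by multilinearity the weighted sum over them acts on each column
separately. It turns the `k`-th column of the determinant for `m` rows into the `k`-th column for
`m + 1` rows minus a multiple of the next one, which does not change the determinant because the
column of index `l` vanishes. By induction on the number of rows the generating function of the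
arrays with `lastPassageTime x ≤ l` is the Toeplitz determinant of the full symbol, which Heine's
identity identifies with an average over `U(l)`.
-/

open Finset

section Andreief

open MeasureTheory Equiv Matrix

lemma sum_sign_mul_sign_mul_prod {ι R : Type*} [Fintype ι] [DecidableEq ι] [CommRing R]
    (A : Matrix ι ι R) :
    ∑ σ : Perm ι, ∑ τ : Perm ι, (σ.sign * τ.sign : R) * ∏ j, A (σ j) (τ j) =
      (Fintype.card ι).factorial * A.det := by
  have sum_right (σ : Perm ι) :
      ∑ τ : Perm ι, (σ.sign * τ.sign : R) * ∏ j, A (σ j) (τ j) = A.det := by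
    calc ∑ τ : Perm ι, (σ.sign * τ.sign : R) * ∏ j, A (σ j) (τ j)
        = σ.sign * (A.submatrix σ id).det := by
          rw [← det_transpose, det_apply', mul_sum]
          simp [mul_assoc]
      _ = A.det := by
          rw [det_permute, ← mul_assoc, ← Int.cast_mul, Int.units_coe_mul_self, Int.cast_one,
            one_mul]
  simp only [sum_right, sum_const, card_univ, Fintype.card_perm, nsmul_eq_mul]

/-- **Andréief's identity**. -/
theorem integral_det_mul_det {ι α 𝕜 : Type*} [Fintype ι] [DecidableEq ι] [RCLike 𝕜]
    [MeasurableSpace α] {μ : Measure α} [SigmaFinite μ] {φ ψ : ι → α → 𝕜}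
    (hφψ : ∀ i k, Integrable (fun t => φ i t * ψ k t) μ) :
    ∫ x : ι → α, (of fun i j => φ i (x j)).det * (of fun i j => ψ i (x j)).det
        ∂Measure.pi (fun _ => μ) =
      (Fintype.card ι).factorial * (of fun i k => ∫ t, φ i t * ψ k t ∂μ).det := by
  have integrable_prod (σ τ : Perm ι) : Integrable
      (fun x : ι → α => ∏ j, φ (σ j) (x j) * ψ (τ j) (x j)) (Measure.pi fun _ => μ) :=
    Integrable.fintype_prod fun j => hφψ (σ j) (τ j)
  have det_mul_det (x : ι → α) :
      (of fun i j => φ i (x j)).det * (of fun i j => ψ i (x j)).det =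
        ∑ σ : Perm ι, ∑ τ : Perm ι,
          (σ.sign * τ.sign : 𝕜) * ∏ j, φ (σ j) (x j) * ψ (τ j) (x j) := by
    simp only [det_apply', of_apply, sum_mul_sum, mul_mul_mul_comm, prod_mul_distrib]
  simp only [det_mul_det]
  rw [← sum_sign_mul_sign_mul_prod, integral_finsetSum _ fun σ _ =>
    integrable_finsetSum _ fun τ _ => (integrable_prod σ τ).const_mul _]
  refine sum_congr rfl fun σ _ => ?_
  rw [integral_finsetSum _ fun τ _ => (integrable_prod σ τ).const_mul _]
  refine sum_congr rfl fun τ _ => ?_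
  rw [integral_const_mul, integral_fintype_prod_eq_prod fun j t => φ (σ j) t * ψ (τ j) t]
  rfl

end Andreief

section FourierCoefficients

open Metric Real

/-- The `r`-th Fourier coefficient of a function on the unit circle. -/
noncomputable def circleCoeff (f : ℂ → ℂ) (r : ℤ) : ℂ :=
  circleAverage (fun z => z ^ (-r) * f z) 0 1

lemma circleIntegrable_zpow_mul {f : ℂ → ℂ} (hf : ContinuousOn f (sphere 0 1)) (r : ℤ) :
    CircleIntegrable (fun z => z ^ r * f z) 0 1 := by
  refine ContinuousOn.circleIntegrable zero_le_one (ContinuousOn.mul (fun z hz => ?_) hf)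
  exact (continuousAt_zpow₀ z r (.inl (ne_of_mem_sphere hz one_ne_zero))).continuousWithinAt

lemma circleCoeff_one_add_mul_zpow_mul {f : ℂ → ℂ} (hf : ContinuousOn f (sphere 0 1)) (β : ℂ)
    (k r : ℤ) :
    circleCoeff (fun z => (1 + β * z ^ k) * f z) r =
      circleCoeff f r + β * circleCoeff f (r - k) := by
  have integrable := circleIntegrable_zpow_mul hf
  unfold circleCoeff
  rw [← smul_eq_mul β, ← circleAverage_fun_smul,
    ← circleAverage_fun_add (integrable _) (integrable _).const_fun_smul]
  refine circleAverage_congr_sphere fun z hz => ?_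
  have hz0 : z ≠ 0 := ne_of_mem_sphere hz (by simp)
  simp only [smul_eq_mul, neg_sub', zpow_sub₀ hz0, zpow_neg]
  field_simp

lemma circleCoeff_comp_inv (f : ℂ → ℂ) (r : ℤ) :
    circleCoeff (fun z => f z⁻¹) r = circleCoeff f (-r) := by
  unfold circleCoeff
  rw [← circleAverage_zero_one_congr_inv]
  simp

lemma circleCoeff_zero_of_diffContOnCl {f : ℂ → ℂ} (hf : DiffContOnCl ℂ f (ball 0 1)) :
    circleCoeff f 0 = f 0 := by
  rw [← abs_one (α := ℝ)] at hf
  simpa [circleCoeff] using hf.circleAverage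

lemma circleCoeff_eq_zero_of_neg {f : ℂ → ℂ} (hf : DiffContOnCl ℂ f (ball 0 1)) {r : ℤ}
    (hr : r < 0) : circleCoeff f r = 0 := by
  obtain ⟨k, hk⟩ := Int.eq_ofNat_of_zero_le (neg_nonneg.2 hr.le)
  have hk0 : k ≠ 0 := by lia
  have hd : DiffContOnCl ℂ (fun z : ℂ => z ^ k * f z) (ball 0 |1|) := by
    rw [abs_one]
    exact (differentiable_pow k).diffContOnCl.smul hf
  simpa [circleCoeff, hk, hk0] using hd.circleAverage

end FourierCoefficients

section HeineIdentity

open MeasureTheory Matrix Metric Real Complex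

lemma ofReal_cueDensity (l : ℕ) (θ : Fin l → ℝ) :
    (cueDensity l θ : ℂ) = ((2 * π : ℂ) ^ l * l.factorial)⁻¹ *
      ((vandermonde fun k => exp (I * θ k)).det *
        (vandermonde fun k => (exp (I * θ k))⁻¹).det) := by
  have inv_eq_conj (k : Fin l) : (exp (I * θ k))⁻¹ = starRingEnd ℂ (exp (I * θ k)) := by
    simp [← exp_conj, ← Complex.exp_neg]
  simp only [inv_eq_conj, cueDensity, det_vandermonde, ← prod_mul_distrib, ← map_sub, mul_conj']
  push_cast
  rw [one_div]

lemma ofReal_cueDensity_mul_prod (f : ℂ → ℂ) (l : ℕ) (θ : Fin l → ℝ) :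
    (cueDensity l θ : ℂ) * ∏ k, f (exp (I * θ k)) = ((2 * π : ℂ) ^ l * l.factorial)⁻¹ *
      ((of fun i j : Fin l => exp (I * θ j) ^ (i : ℕ) * f (exp (I * θ j))).det *
        (of fun i j : Fin l => (exp (I * θ j))⁻¹ ^ (i : ℕ)).det) := by
  have det_left : (of fun i j : Fin l => exp (I * θ j) ^ (i : ℕ) * f (exp (I * θ j))).det =
      (∏ k, f (exp (I * θ k))) * (vandermonde fun k => exp (I * θ k)).det := by
    rw [← det_mul_column, ← det_transpose]
    congr 1
    ext i j
    simp [mul_comm]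
  have det_right : (of fun i j : Fin l => (exp (I * θ j))⁻¹ ^ (i : ℕ)).det =
      (vandermonde fun k => (exp (I * θ k))⁻¹).det := det_transpose _
  rw [ofReal_cueDensity, det_left, det_right]
  ring

lemma setIntegral_exp_I_mul (f : ℂ → ℂ) :
    ∫ θ in Set.Ico (0 : ℝ) (2 * π), f (exp (I * θ)) = 2 * π * circleAverage f 0 1 := by
  have two_pi_ne_zero : (2 * π : ℂ) ≠ 0 := by simp [Real.pi_ne_zero]
  rw [integral_Ico_eq_integral_Ioc, ← intervalIntegral.integral_of_le two_pi_pos.le,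
    circleAverage_def, real_smul]
  push_cast
  rw [mul_inv_cancel_left₀ two_pi_ne_zero]
  simp [circleMap, mul_comm]

lemma integrableOn_exp_I_mul {f : ℂ → ℂ} (hf : CircleIntegrable f 0 1) :
    IntegrableOn (fun θ : ℝ => f (exp (I * θ))) (Set.Ico 0 (2 * π)) := by
  rw [CircleIntegrable, intervalIntegrable_iff_integrableOn_Ico_of_le two_pi_pos.le] at hf
  simpa [circleMap, mul_comm] using hf

/-- **Heine's identity**. -/
theorem cueAverage_prod_eq_det {f : ℂ → ℂ} (hf : ContinuousOn f (sphere 0 1)) (l : ℕ) :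
    cueAverage l (fun θ => ∏ k, f (exp (I * θ k))) =
      (of fun i k : Fin l => circleCoeff f ((k : ℤ) - i)).det := by
  let arc : Set ℝ := Set.Ico 0 (2 * π)
  let φ (i : Fin l) (θ : ℝ) : ℂ := exp (I * θ) ^ (i : ℕ) * f (exp (I * θ))
  let ψ (k : Fin l) (θ : ℝ) : ℂ := (exp (I * θ))⁻¹ ^ (k : ℕ)
  let F (i k : Fin l) (z : ℂ) : ℂ := z ^ (-((k : ℤ) - i)) * f z
  have φ_mul_ψ (i k : Fin l) (θ : ℝ) : φ i θ * ψ k θ = F i k (exp (I * θ)) := by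
    simp only [φ, ψ, F, neg_sub, zpow_sub₀ (Complex.exp_ne_zero _), zpow_natCast, inv_pow,
      div_eq_mul_inv, mul_right_comm]
  have integrable (i k : Fin l) : IntegrableOn (fun θ => φ i θ * ψ k θ) arc := by
    simp only [φ_mul_ψ]
    exact integrableOn_exp_I_mul (circleIntegrable_zpow_mul hf _)
  have integral_eq (i k : Fin l) :
      ∫ θ in arc, φ i θ * ψ k θ = 2 * π * circleCoeff f ((k : ℤ) - i) := by
    simp only [φ_mul_ψ]
    exact setIntegral_exp_I_mul (F i k)
  have factorial_ne_zero : (l.factorial : ℂ) ≠ 0 := mod_cast l.factorial_ne_zero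
  calc cueAverage l (fun θ => ∏ k, f (exp (I * θ k)))
      = ((2 * π : ℂ) ^ l * l.factorial)⁻¹ * ∫ θ : Fin l → ℝ, (of fun i j => φ i (θ j)).det *
          (of fun i j => ψ i (θ j)).det ∂Measure.pi fun _ => volume.restrict arc := by
        simp only [cueAverage, ofReal_cueDensity_mul_prod, integral_const_mul]
        rw [volume_pi, Measure.restrict_pi_pi]
    _ = ((2 * π : ℂ) ^ l * l.factorial)⁻¹ * (l.factorial *
          ((2 * π : ℂ) • of fun i k : Fin l => circleCoeff f ((k : ℤ) - i)).det) := by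
        rw [integral_det_mul_det integrable, Fintype.card_fin]
        simp only [integral_eq]
        rfl
    _ = (of fun i k : Fin l => circleCoeff f ((k : ℤ) - i)).det := by
        rw [det_smul, Fintype.card_fin]
        field_simp

end HeineIdentity

section Symbol

open Metric Real

variable {ι κ : Type*} {a : ι → ℂ} {b : κ → ℂ}

/-- The symbol `∏ⱼ (1 + bⱼ z) ∏ᵢ (1 - aᵢ / z)⁻¹` of the Toeplitz determinant, restricted to the
rows `i ∈ s` and the columns `j ∈ t` of the array. -/
noncomputable def symbol (a : ι → ℂ) (b : κ → ℂ) (s : Finset ι) (t : Finset κ) (z : ℂ) : ℂ :=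
  (∏ j ∈ t, (1 + b j * z)) * (∏ i ∈ s, (1 - a i * z⁻¹))⁻¹

lemma one_sub_mul_ne_zero {α z : ℂ} (hα : ‖α‖ < 1) (hz : ‖z‖ ≤ 1) : 1 - α * z ≠ 0 := by
  intro h
  have norm_lt : ‖α * z‖ < 1 := by
    rw [norm_mul]
    exact mul_lt_one_of_nonneg_of_lt_one_left (norm_nonneg α) hα hz
  rw [← sub_eq_zero.1 h, norm_one] at norm_lt
  exact norm_lt.false

lemma prod_symbol {σ : Type*} [Fintype σ] [Fintype ι] [Fintype κ] (a : ι → ℂ) (b : κ → ℂ)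
    (z : σ → ℂ) :
    ∏ k, symbol a b univ univ (z k) =
      (∏ j, ∏ k, (1 + b j * z k)) * (∏ i, ∏ k, (1 - a i * (z k)⁻¹))⁻¹ := by
  simp only [symbol, prod_mul_distrib, prod_inv_distrib, prod_comm (t := (univ : Finset σ))]

lemma continuousOn_symbol (ha : ∀ i, ‖a i‖ < 1) (b : κ → ℂ) (s : Finset ι) (t : Finset κ) :
    ContinuousOn (symbol a b s t) (sphere 0 1) := by
  have inv_continuousOn : ContinuousOn (fun z : ℂ => z⁻¹) (sphere 0 1) :=
    continuousOn_inv₀.mono fun z hz => ne_of_mem_sphere hz one_ne_zero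
  refine ContinuousOn.mul (by fun_prop) (ContinuousOn.inv₀ (by fun_prop) fun z hz => ?_)
  refine prod_ne_zero_iff.2 fun i _ => one_sub_mul_ne_zero (ha i) ?_
  rw [norm_inv, mem_sphere_zero_iff_norm.1 hz, inv_one]

lemma circleCoeff_symbol_insert_column [DecidableEq κ] (ha : ∀ i, ‖a i‖ < 1) (b : κ → ℂ)
    (s : Finset ι) {t : Finset κ} {j : κ} (hj : j ∉ t) (r : ℤ) :
    circleCoeff (symbol a b s (insert j t)) r =
      circleCoeff (symbol a b s t) r + b j * circleCoeff (symbol a b s t) (r - 1) := by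
  rw [← circleCoeff_one_add_mul_zpow_mul (continuousOn_symbol ha b s t)]
  congr 1
  ext z
  rw [symbol, prod_insert hj, mul_assoc, zpow_one, symbol]

lemma circleCoeff_symbol_insert_row [DecidableEq ι] (ha : ∀ i, ‖a i‖ < 1) (b : κ → ℂ)
    {s : Finset ι} {i : ι} (hi : i ∉ s) (t : Finset κ) (r : ℤ) :
    circleCoeff (symbol a b s t) r = circleCoeff (symbol a b (insert i s) t) r -
      a i * circleCoeff (symbol a b (insert i s) t) (r + 1) := by
  have h := circleCoeff_one_add_mul_zpow_mul (continuousOn_symbol ha b (insert i s) t) (-a i) (-1) r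
  rw [sub_neg_eq_add, neg_mul, ← sub_eq_add_neg] at h
  rw [← h]
  refine circleAverage_congr_sphere fun z hz => ?_
  rw [abs_one, mem_sphere_zero_iff_norm] at hz
  have hne : 1 - a i * z⁻¹ ≠ 0 := one_sub_mul_ne_zero (ha i) (by rw [norm_inv, hz, inv_one])
  have symbol_eq : symbol a b s t z = (1 - a i * z⁻¹) * symbol a b (insert i s) t z := by
    rw [symbol, symbol, prod_insert hi, mul_inv, mul_left_comm, mul_inv_cancel_left₀ hne]
  simp only [symbol_eq, zpow_neg_one, neg_mul, ← sub_eq_add_neg]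

lemma circleCoeff_symbol_eq_zero_of_pos (ha : ∀ i, ‖a i‖ < 1) (b : κ → ℂ) (s : Finset ι) {r : ℤ}
    (hr : 0 < r) : circleCoeff (symbol a b s ∅) r = 0 := by
  let f (z : ℂ) : ℂ := (∏ i ∈ s, (1 - a i * z))⁻¹
  have hf : DiffContOnCl ℂ f (ball 0 1) := by
    refine DifferentiableOn.diffContOnCl ?_
    rw [closure_ball _ one_ne_zero]
    refine DifferentiableOn.inv (by fun_prop) fun z hz => ?_
    exact prod_ne_zero_iff.2 fun i _ => one_sub_mul_ne_zero (ha i) (mem_closedBall_zero_iff.1 hz)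
  have symbol_eq : symbol a b s ∅ = fun z => f z⁻¹ := by
    ext z
    simp [symbol, f]
  rw [symbol_eq, circleCoeff_comp_inv, circleCoeff_eq_zero_of_neg hf (neg_lt_zero.2 hr)]

lemma diffContOnCl_symbol_empty (a : ι → ℂ) (b : κ → ℂ) (t : Finset κ) :
    DiffContOnCl ℂ (symbol a b ∅ t) (ball 0 1) := by
  change DiffContOnCl ℂ (fun z => (∏ j ∈ t, (1 + b j * z)) * (∏ i ∈ ∅, (1 - a i * z⁻¹))⁻¹) _
  simp only [prod_empty, inv_one, mul_one]
  exact Differentiable.diffContOnCl (by fun_prop)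

end Symbol

section Thresholds

variable {l m n : ℕ} {c : ℕ → ℕ}

/-- Every path that stays in the columns `j < c k` has passage time at most `k`, for all `k`. -/
def RespectsThreshold (x : Fin m → Fin n → ℕ) (c : ℕ → ℕ) : Prop :=
  ∀ p : Fin m → Fin n, Monotone p → ∀ k, (∀ i, (p i : ℕ) < c k) → ∑ i, x i (p i) ≤ k

/-- One more than the largest element of `s`, or `u` if all elements of `s` are below `u`. -/
def blockEnd (u : ℕ) (s : Finset ℕ) : ℕ :=
  max u (s.sup Nat.succ)

/-- The thresholds that the rows below have to respect when the nonzero entries of the top row are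
the ones in the columns `s`. -/
def updateThreshold (c : ℕ → ℕ) (s : Finset ℕ) (k : ℕ) : ℕ :=
  blockEnd (c k) (s ∩ Ico (c k) (c (k + 1)))

/-- Monotone thresholds for arrays with `n` columns, equal to `n` from the index `l` on. -/
structure IsThreshold (l n : ℕ) (c : ℕ → ℕ) : Prop where
  monotone : Monotone c
  eq_of_le : ∀ k, l ≤ k → c k = n

lemma lastPassageTime_le_iff_respectsThreshold (x : Fin m → Fin n → ℕ) :
    lastPassageTime x ≤ l ↔ RespectsThreshold x fun k => if k < l then 0 else n := by
  simp only [lastPassageTime, Finset.sup_le_iff, mem_filter, mem_univ, true_and]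
  constructor
  · intro h p hp k hk
    by_cases hkl : k < l
    · have : IsEmpty (Fin m) := ⟨fun i => by simpa [hkl] using hk i⟩
      simp
    · exact (h p fun i i' => (hp ·)).trans (not_lt.1 hkl)
  · intro h p hp
    exact h p (fun i i' => hp i i') l (by simp)

lemma isThreshold_ite (l n : ℕ) : IsThreshold l n fun k => if k < l then 0 else n where
  monotone := by
    intro k k' hk
    dsimp only
    split_ifs <;> lia
  eq_of_le k hk := if_neg hk.not_gt

lemma IsThreshold.le (hc : IsThreshold l n c) (k : ℕ) : c k ≤ n :=
  (hc.monotone (Nat.le_add_left k l)).trans_eq (hc.eq_of_le _ (Nat.le_add_right l k))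

lemma lt_updateThreshold_iff {s : Finset ℕ} {k d : ℕ} :
    d < updateThreshold c s k ↔ d < c k ∨ ∃ j ∈ s, (c k ≤ j ∧ j < c (k + 1)) ∧ d ≤ j := by
  simp [updateThreshold, blockEnd, Finset.lt_sup_iff, and_assoc]

lemma IsThreshold.update (hc : IsThreshold l n c) (s : Finset ℕ) :
    IsThreshold l n (updateThreshold c s) where
  monotone := by
    refine monotone_nat_of_le_succ fun k => le_of_forall_lt fun d hd => ?_
    refine lt_updateThreshold_iff.2 (.inl ?_)
    rcases lt_updateThreshold_iff.1 hd with h | ⟨j, -, hj, hdj⟩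
    · exact h.trans_le (hc.monotone k.le_succ)
    · exact hdj.trans_lt hj.2
  eq_of_le k hk := by
    simp [updateThreshold, blockEnd, hc.eq_of_le k hk, hc.eq_of_le (k + 1) (hk.trans k.le_succ)]

lemma monotone_snoc {p : Fin m → Fin n} (hp : Monotone p) {j : Fin n} (hj : ∀ i, p i ≤ j) :
    Monotone (Fin.snoc p j : Fin (m + 1) → Fin n) := by
  intro i i' hi
  induction i' using Fin.lastCases with
  | last => induction i using Fin.lastCases <;> simp [hj]
  | cast i' =>
    induction i using Fin.lastCases with
    | last => exact absurd hi (Fin.castSucc_lt_last i').not_ge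
    | cast i => simpa using hp (Fin.castSucc_le_castSucc_iff.1 hi)

lemma RespectsThreshold.sum_add_le {x : Fin (m + 1) → Fin n → ℕ} (h : RespectsThreshold x c)
    {p : Fin m → Fin n} (hp : Monotone p) {j : Fin n} (hj : ∀ i, p i ≤ j) {k : ℕ}
    (hjk : (j : ℕ) < c k) : ∑ i, Fin.init x i (p i) + x (Fin.last m) j ≤ k := by
  have := h _ (monotone_snoc hp hj) k fun i => by
    induction i using Fin.lastCases with
    | last => simpa using hjk
    | cast i => simpa using (Fin.val_le_of_le (hj i)).trans_lt hjk
  simpa [Fin.sum_univ_castSucc, Fin.init] using this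

variable {s : Finset ℕ} {x : Fin (m + 1) → Fin n → ℕ}

lemma RespectsThreshold.disjoint_range (h : RespectsThreshold x c) (hs : s ⊆ range n)
    (hx : ∀ j, x (Fin.last m) j = if (j : ℕ) ∈ s then 1 else 0) : Disjoint s (range (c 0)) := by
  refine disjoint_left.2 fun j hjs hj => ?_
  have le_zero := h.sum_add_le (monotone_const (c := ⟨j, mem_range.1 (hs hjs)⟩)) (fun _ => le_rfl)
    (mem_range.1 hj)
  simp [hx, hjs] at le_zero

lemma RespectsThreshold.init (h : RespectsThreshold x c) (hs : s ⊆ range n)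
    (hx : ∀ j, x (Fin.last m) j = if (j : ℕ) ∈ s then 1 else 0) :
    RespectsThreshold (Fin.init x) (updateThreshold c s) := by
  intro p hp k hpk
  cases m with
  | zero => simp
  | succ m =>
    have le_last (i : Fin (m + 1)) : p i ≤ p (Fin.last m) := hp (Fin.le_last i)
    rcases lt_updateThreshold_iff.1 (hpk (Fin.last m)) with hlt | ⟨j, hjs, hj, hle⟩
    · exact le_of_add_le_left (h.sum_add_le hp le_last hlt)
    · have sum_add_le := h.sum_add_le (j := ⟨j, mem_range.1 (hs hjs)⟩) hp
        (fun i => (le_last i).trans hle) hj.2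
      simpa [hx, hjs] using sum_add_le

lemma exists_le_lt_succ {j k : ℕ} (hj : c 0 ≤ j) (hjk : j < c k) :
    ∃ k' < k, c k' ≤ j ∧ j < c (k' + 1) := by
  induction k with
  | zero => exact absurd hjk hj.not_gt
  | succ k ih =>
    rcases lt_or_ge j (c k) with hlt | hle
    · obtain ⟨k', hk', h⟩ := ih hlt
      exact ⟨k', hk'.trans k.lt_succ_self, h⟩
    · exact ⟨k, k.lt_succ_self, hle, hjk⟩

lemma respectsThreshold_of_init (hx : ∀ j, x (Fin.last m) j = if (j : ℕ) ∈ s then 1 else 0)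
    (hs : Disjoint s (range (c 0))) (h : RespectsThreshold (Fin.init x) (updateThreshold c s)) :
    RespectsThreshold x c := by
  intro p hp k hpk
  have hp_init : Monotone (Fin.init p) := hp.comp (Fin.strictMono_castSucc.monotone)
  have le_last (i : Fin m) : Fin.init p i ≤ p (Fin.last m) := hp (Fin.le_last _)
  rw [Fin.sum_univ_castSucc, hx]
  split_ifs with hmem
  · have hle : c 0 ≤ p (Fin.last m) := by simpa using disjoint_left.1 hs hmem
    obtain ⟨k', hk', hblock⟩ := exists_le_lt_succ hle (hpk _)
    have sum_le := h _ hp_init k' fun i =>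
      lt_updateThreshold_iff.2 (.inr ⟨_, hmem, hblock, le_last i⟩)
    exact (Nat.succ_le_succ sum_le).trans hk'
  · exact h _ hp_init k fun i => lt_updateThreshold_iff.2 (.inl (hpk _))

theorem respectsThreshold_succ_iff (hs : s ⊆ range n)
    (hx : ∀ j, x (Fin.last m) j = if (j : ℕ) ∈ s then 1 else 0) :
    RespectsThreshold x c ↔
      Disjoint s (range (c 0)) ∧ RespectsThreshold (Fin.init x) (updateThreshold c s) :=
  ⟨fun h => ⟨h.disjoint_range hs hx, h.init hs hx⟩,
    fun h => respectsThreshold_of_init hx h.1 h.2⟩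

end Thresholds

section ThresholdDeterminants

open Matrix Function

variable {R : Type*} [CommRing R]

lemma det_sub_mul_succ {l : ℕ} (A : Fin l → ℕ → R) (γ : ℕ → R) (hA : ∀ i, A i l = 0) :
    (of fun i k : Fin l => A i k - γ k * A i (k + 1)).det = (of fun i k : Fin l => A i k).det := by
  cases l with
  | zero => simp
  | succ l =>
    rw [← det_submatrix_equiv_self Fin.revPerm,
      ← det_submatrix_equiv_self Fin.revPerm (of fun i k : Fin (l + 1) => A i k)]
    refine (det_eq_of_forall_col_eq_smul_add_pred (fun k => γ k.succ.rev) (fun i => ?_)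
      fun i k => ?_).symm
    · simp [hA]
    · have val_rev : (k.castSucc.rev : ℕ) = k.succ.rev + 1 := by
        simp only [Fin.val_rev, Fin.val_castSucc, Fin.val_succ]
        lia
      simp only [submatrix_apply, of_apply, Fin.revPerm_apply, val_rev, sub_add_cancel]

lemma sum_powerset_biUnion {ι α M : Type*} [Fintype ι] [DecidableEq ι] [DecidableEq α]
    [AddCommMonoid M] {A : ι → Finset α} (hA : Pairwise (Disjoint on A))
    (F : (ι → Finset α) → M) :
    ∑ s ∈ (univ.biUnion A).powerset, F (fun k => s ∩ A k) =
      ∑ r ∈ Fintype.piFinset fun k => (A k).powerset, F r := by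
  refine sum_nbij' (fun s k => s ∩ A k) (fun r => univ.biUnion r) ?_ ?_ ?_ ?_ ?_
  · simp
  · intro r hr
    simp only [Fintype.mem_piFinset, mem_powerset] at hr ⊢
    exact biUnion_mono fun k _ => hr k
  · intro s hs
    rw [← inter_biUnion, inter_eq_left.2 (mem_powerset.1 hs)]
  · intro r hr
    simp only [Fintype.mem_piFinset, mem_powerset] at hr
    ext k j
    simp only [mem_inter, mem_biUnion, mem_univ, true_and]
    constructor
    · rintro ⟨⟨k', hj⟩, hjk⟩
      obtain rfl : k' = k := hA.eq (not_disjoint_iff.2 ⟨j, hr k' hj, hjk⟩)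
      exact hj
    · exact fun hj => ⟨⟨k, hj⟩, hr k hj⟩
  · simp

lemma sum_powerset_biUnion_det {ι α : Type*} [Fintype ι] [DecidableEq ι] [DecidableEq α]
    {A : ι → Finset α} (hA : Pairwise (Disjoint on A)) (w : α → R) (F : ι → ι → Finset α → R) :
    ∑ s ∈ (univ.biUnion A).powerset,
        (∏ j ∈ s, w j) * (of fun i k => F i k (s ∩ A k)).det =
      (of fun i k => ∑ s ∈ (A k).powerset, (∏ j ∈ s, w j) * F i k s).det := by
  have prod_eq {s : Finset α} (hs : s ∈ (univ.biUnion A).powerset) :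
      ∏ j ∈ s, w j = ∏ k, ∏ j ∈ s ∩ A k, w j := by
    rw [← prod_biUnion fun k _ k' _ hk =>
      (hA hk).mono inter_subset_right inter_subset_right, ← inter_biUnion,
      inter_eq_left.2 (mem_powerset.1 hs)]
  calc _ = ∑ s ∈ (univ.biUnion A).powerset,
        (of fun i k => (∏ j ∈ s ∩ A k, w j) * F i k (s ∩ A k)).det :=
        sum_congr rfl fun s hs => by rw [prod_eq hs, ← det_mul_row]; rfl
    _ = ∑ r ∈ Fintype.piFinset fun k => (A k).powerset,
        (of fun i k => (∏ j ∈ r k, w j) * F i k (r k)).det :=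
        sum_powerset_biUnion hA fun r => (of fun i k => (∏ j ∈ r k, w j) * F i k (r k)).det
    _ = (of fun i k => ∑ s ∈ (A k).powerset, (∏ j ∈ s, w j) * F i k s).det := by
        have map_sum := (detRowAlternating (R := R) (n := ι)).toMultilinearMap.map_sum_finset
          (fun k s i => (∏ j ∈ s, w j) * F i k s) (fun k => (A k).powerset)
        rw [← det_transpose (of fun i k => ∑ s ∈ (A k).powerset, _)]
        refine (sum_congr rfl fun r _ => (det_transpose _).symm).trans
          (map_sum.symm.trans (congrArg det ?_))
        ext k i
        simp

lemma pairwise_disjoint_Ico_add_one {c : ℕ → ℕ} (hc : Monotone c) (l : ℕ) :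
    Pairwise (Disjoint on fun k : Fin l => Ico (c k) (c (k + 1))) := by
  intro k k' hk
  rw [onFun, ← disjoint_coe, coe_Ico, coe_Ico]
  exact hc.pairwise_disjoint_on_Ico_succ (Fin.val_ne_of_ne hk)

lemma biUnion_Ico_add_one {c : ℕ → ℕ} (hc : Monotone c) (l : ℕ) :
    univ.biUnion (fun k : Fin l => Ico (c k) (c (k + 1))) = Ico (c 0) (c l) := by
  ext j
  simp only [mem_biUnion, mem_univ, true_and, mem_Ico]
  constructor
  · rintro ⟨k, hk⟩
    exact ⟨(hc (Nat.zero_le _)).trans hk.1, hk.2.trans_le (hc k.isLt)⟩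
  · rintro ⟨h0, hl⟩
    obtain ⟨k, hkl, hk⟩ := exists_le_lt_succ h0 hl
    exact ⟨⟨k, hkl⟩, hk⟩

/-- Coefficients `g m c r` in `z ^ r` of a Laurent series in which the first `m` rows and the
columns `j ≥ c` of an array with `n` columns are present: passing from `c + 1` to `c` adjoins a
factor `1 + b c * z`, and passing from `m` to `m + 1` a factor `(1 - a m / z)⁻¹`. -/
structure IsCoeffFamily (n : ℕ) (a b : ℕ → R) (g : ℕ → ℕ → ℤ → R) : Prop where
  column : ∀ m c r, c < n → g m c r = g m (c + 1) r + b c * g m (c + 1) (r - 1)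
  row : ∀ m c r, g m c r = g (m + 1) c r - a m * g (m + 1) c (r + 1)
  eq_zero_of_pos : ∀ m r, 0 < r → g m n r = 0
  eq_zero_of_neg : ∀ c r, r < 0 → g 0 c r = 0
  eq_one : ∀ c, g 0 c 0 = 1

/-- The matrix attached to the thresholds `c`, whose `k`-th column is formed from the coefficients
`g (c k)`. It is a Toeplitz matrix if `c` is constant. -/
def thresholdMatrix (l : ℕ) (g : ℕ → ℤ → R) (c : ℕ → ℕ) : Matrix (Fin l) (Fin l) R :=
  of fun i k => g (c k) ((k : ℤ) - i)

lemma blockEnd_of_forall_lt {u v : ℕ} {s : Finset ℕ} (hs : ∀ j ∈ s, j < v) (huv : u ≤ v) :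
    blockEnd u (insert v s) = v + 1 := by
  have sup_le : s.sup Nat.succ ≤ v := Finset.sup_le hs
  rw [blockEnd, sup_insert, max_eq_left (sup_le.trans v.le_succ),
    max_eq_right (huv.trans v.le_succ)]

namespace IsCoeffFamily

variable {l n : ℕ} {a b : ℕ → R} {g : ℕ → ℕ → ℤ → R} {c : ℕ → ℕ}

lemma sum_powerset_Ico (hg : IsCoeffFamily n a b g) (m : ℕ) {u v : ℕ} (huv : u ≤ v) (hv : v ≤ n)
    (r : ℤ) :
    ∑ s ∈ (Ico u v).powerset, (∏ j ∈ s, a m * b j) * g m (blockEnd u s) r =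
      g (m + 1) u r - a m * (∏ j ∈ Ico u v, (1 + a m * b j)) * g (m + 1) v (r + 1) := by
  induction v, huv using Nat.le_induction with
  | base => simp [blockEnd, hg.row m u r]
  | succ v huv ih =>
    have notMem {s : Finset ℕ} (hs : s ∈ (Ico u v).powerset) : v ∉ s := fun h =>
      right_notMem_Ico (mem_powerset.1 hs h)
    have blockEnd_insert {s : Finset ℕ} (hs : s ∈ (Ico u v).powerset) :
        blockEnd u (insert v s) = v + 1 :=
      blockEnd_of_forall_lt (fun j hj => (mem_Ico.1 (mem_powerset.1 hs hj)).2) huv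
    have sum_insert : ∑ s ∈ (Ico u v).powerset,
          (∏ j ∈ insert v s, a m * b j) * g m (blockEnd u (insert v s)) r =
        (∏ j ∈ Ico u v, (1 + a m * b j)) * (a m * b v * g m (v + 1) r) := by
      rw [prod_one_add, sum_mul]
      refine sum_congr rfl fun s hs => ?_
      rw [prod_insert (notMem hs), blockEnd_insert hs]
      ring
    rw [← insert_Ico_right_eq_Ico_add_one huv, sum_powerset_insert right_notMem_Ico,
      ih (by lia), sum_insert, prod_insert right_notMem_Ico, hg.row m (v + 1) r,
      hg.column (m + 1) v (r + 1) (by lia), add_sub_cancel_right]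
    ring

lemma det_thresholdMatrix_zero (hg : IsCoeffFamily n a b g) (l : ℕ) (c : ℕ → ℕ) :
    (thresholdMatrix l (g 0) c).det = 1 := by
  rw [det_of_isUpperTriangular]
  · simp [thresholdMatrix, hg.eq_one]
  · intro i k hki
    have : (k : ℕ) < i := hki
    exact hg.eq_zero_of_neg _ _ (by lia)

theorem sum_det_thresholdMatrix_updateThreshold (hg : IsCoeffFamily n a b g)
    (hc : IsThreshold l n c) (m : ℕ) :
    ∑ s ∈ (Ico (c 0) n).powerset,
        (∏ j ∈ s, a m * b j) * (thresholdMatrix l (g m) (updateThreshold c s)).det =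
      (thresholdMatrix l (g (m + 1)) c).det := by
  calc _ = (of fun i k : Fin l => ∑ s ∈ (Ico (c k) (c (k + 1))).powerset,
        (∏ j ∈ s, a m * b j) * g m (blockEnd (c k) s) ((k : ℤ) - i)).det := by
        rw [← hc.eq_of_le l le_rfl, ← biUnion_Ico_add_one hc.monotone l]
        exact sum_powerset_biUnion_det (pairwise_disjoint_Ico_add_one hc.monotone l) _
          fun i k s => g m (blockEnd (c k) s) ((k : ℤ) - i)
    _ = (of fun i k : Fin l => g (m + 1) (c k) ((k : ℤ) - i) -
          (a m * ∏ j ∈ Ico (c k) (c (k + 1)), (1 + a m * b j)) *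
            g (m + 1) (c (k + 1)) (((k + 1 : ℕ) : ℤ) - i)).det := by
        simp only [hg.sum_powerset_Ico m (hc.monotone (Nat.le_succ _)) (hc.le _),
          Nat.cast_succ, sub_add_eq_add_sub]
    _ = (thresholdMatrix l (g (m + 1)) c).det := by
        refine det_sub_mul_succ (fun i k => g (m + 1) (c k) ((k : ℤ) - i))
          (fun k => a m * ∏ j ∈ Ico (c k) (c (k + 1)), (1 + a m * b j)) fun i => ?_
        rw [hc.eq_of_le l le_rfl]
        exact hg.eq_zero_of_pos _ _ (sub_pos.2 (Nat.cast_lt.2 i.isLt))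

end IsCoeffFamily

end ThresholdDeterminants

section IndicatorArrays

open Matrix

/-- The array of zeros and ones whose nonzero entries in row `i` are those in the columns `X i`. -/
def indicatorArray {ι κ : Type*} [DecidableEq κ] (X : ι → Finset κ) (i : ι) (j : κ) : ℕ :=
  if j ∈ X i then 1 else 0

lemma injective_indicatorArray {ι κ : Type*} [DecidableEq κ] :
    Function.Injective (indicatorArray : (ι → Finset κ) → ι → κ → ℕ) := by
  intro X X' h
  ext i j
  have hij : (if j ∈ X i then 1 else 0) = if j ∈ X' i then 1 else 0 := congrFun₂ h i j
  split_ifs at hij <;> simp_all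

lemma exists_indicatorArray_eq {ι κ : Type*} [Finite κ] [DecidableEq κ] {y : ι → κ → ℕ}
    (hy : ∀ i j, y i j = 0 ∨ y i j = 1) :
    ∃ X, indicatorArray X = y := by
  cases nonempty_fintype κ
  refine ⟨fun i => {j | y i j = 1}, ?_⟩
  ext i j
  rcases hy i j with h | h <;> simp [indicatorArray, h]

lemma prod_pow_indicatorArray {ι κ R : Type*} [Fintype ι] [Fintype κ] [DecidableEq κ]
    [CommMonoid R] (w : ι → κ → R) (X : ι → Finset κ) :
    ∏ i, ∏ j, w i j ^ indicatorArray X i j = ∏ i, ∏ j ∈ X i, w i j := by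
  simp [indicatorArray]

lemma sum_eq_sum_sum_snoc {α M : Type*} [Fintype α] [AddCommMonoid M] {m : ℕ}
    (F : (Fin (m + 1) → α) → M) :
    ∑ X, F X = ∑ s, ∑ X : Fin m → α, F (Fin.snoc X s) := by
  rw [← (Fin.snocEquiv fun _ => α).sum_comp, Fintype.sum_prod_type]
  rfl

lemma sum_map_valEmbedding {M : Type*} [AddCommMonoid M] (n : ℕ) (F : Finset ℕ → M) :
    ∑ s : Finset (Fin n), F (s.map Fin.valEmbedding) = ∑ s ∈ (range n).powerset, F s := by
  have powerset_eq : (range n).powerset =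
      univ.image fun s : Finset (Fin n) => s.map Fin.valEmbedding := by
    ext s
    rw [mem_powerset, ← Nat.Iio_eq_range, ← Fin.map_valEmbedding_univ, subset_map_iff]
    simp [eq_comm]
  rw [powerset_eq, sum_image (Finset.map_injective _).injOn]

lemma filter_disjoint_range_powerset_range (u n : ℕ) :
    {s ∈ (range n).powerset | Disjoint s (range u)} = (Ico u n).powerset := by
  ext s
  simp only [mem_filter, mem_powerset, disjoint_left, subset_iff, mem_range, mem_Ico]
  grind

variable {R : Type*} [CommRing R] {l m n : ℕ} {a b : ℕ → R} {g : ℕ → ℕ → ℤ → R} {c : ℕ → ℕ}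

lemma respectsThreshold_indicatorArray_snoc (X : Fin m → Finset (Fin n)) (s : Finset (Fin n)) :
    RespectsThreshold (indicatorArray (Fin.snoc X s : Fin (m + 1) → Finset (Fin n))) c ↔
      Disjoint (s.map Fin.valEmbedding) (range (c 0)) ∧
        RespectsThreshold (indicatorArray X) (updateThreshold c (s.map Fin.valEmbedding)) := by
  have init_eq : Fin.init (indicatorArray (Fin.snoc X s : Fin (m + 1) → Finset (Fin n))) =
      indicatorArray X := by
    ext i j
    simp [Fin.init, indicatorArray]
  rw [← init_eq]
  refine respectsThreshold_succ_iff ?_ fun j => by simp [indicatorArray, Fin.val_inj]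
  intro j hj
  obtain ⟨j, -, rfl⟩ := mem_map.1 hj
  exact mem_range.2 j.isLt

open Classical in
theorem IsCoeffFamily.sum_respectsThreshold (hg : IsCoeffFamily n a b g) (m : ℕ)
    (hc : IsThreshold l n c) :
    ∑ X : Fin m → Finset (Fin n) with RespectsThreshold (indicatorArray X) c,
        ∏ i, ∏ j ∈ X i, a i * b j =
      (thresholdMatrix l (g m) c).det := by
  induction m generalizing c with
  | zero =>
    simp [hg.det_thresholdMatrix_zero, RespectsThreshold]
  | succ m ih =>
    let weight (X : Fin m → Finset (Fin n)) : R := ∏ i, ∏ j ∈ X i, a i * b j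
    calc ∑ X : Fin (m + 1) → Finset (Fin n) with RespectsThreshold (indicatorArray X) c,
          ∏ i, ∏ j ∈ X i, a i * b j
        = ∑ s : Finset (Fin n), if Disjoint (s.map Fin.valEmbedding) (range (c 0)) then
            (∏ j ∈ s.map Fin.valEmbedding, a m * b j) *
              ∑ X with RespectsThreshold (indicatorArray X)
                (updateThreshold c (s.map Fin.valEmbedding)), weight X else 0 := by
          rw [sum_filter, sum_eq_sum_sum_snoc]
          refine sum_congr rfl fun s _ => ?_
          simp only [respectsThreshold_indicatorArray_snoc, ite_and,
            Fin.prod_univ_castSucc]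
          split_ifs <;> simp [mul_sum, sum_filter, weight, mul_comm]
      _ = ∑ s ∈ (Ico (c 0) n).powerset,
            (∏ j ∈ s, a m * b j) * (thresholdMatrix l (g m) (updateThreshold c s)).det := by
          simp only [weight, ih (hc.update _)]
          rw [sum_map_valEmbedding n fun s => if Disjoint s (range (c 0)) then
            (∏ j ∈ s, a m * b j) * (thresholdMatrix l (g m) (updateThreshold c s)).det else 0,
            ← sum_filter, filter_disjoint_range_powerset_range]
      _ = (thresholdMatrix l (g (m + 1)) c).det :=
          hg.sum_det_thresholdMatrix_updateThreshold hc m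

end IndicatorArrays

section GeneratingFunction

open Metric Matrix

lemma isCoeffFamily_circleCoeff_symbol {a : ℕ → ℂ} (ha : ∀ i, ‖a i‖ < 1) (b : ℕ → ℂ) (n : ℕ) :
    IsCoeffFamily n a b fun m c => circleCoeff (symbol a b (range m) (Ico c n)) where
  column m c r hc := by
    rw [← insert_Ico_add_one_left_eq_Ico hc]
    exact circleCoeff_symbol_insert_column ha b (range m) (by simp) r
  row m c r := by
    rw [range_add_one]
    exact circleCoeff_symbol_insert_row ha b notMem_range_self (Ico c n) r
  eq_zero_of_pos m r hr := by
    rw [Ico_self]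
    exact circleCoeff_symbol_eq_zero_of_pos ha b (range m) hr
  eq_zero_of_neg c r hr := by
    rw [range_zero, circleCoeff_eq_zero_of_neg (diffContOnCl_symbol_empty a b _) hr]
  eq_one c := by
    rw [range_zero, circleCoeff_zero_of_diffContOnCl (diffContOnCl_symbol_empty a b _)]
    simp [symbol]

lemma sum_lastPassageTime_le_eq_det {a : ℕ → ℂ} (ha : ∀ i, ‖a i‖ < 1) (b : ℕ → ℂ) (l m n : ℕ) :
    ∑ X : Fin m → Finset (Fin n) with lastPassageTime (indicatorArray X) ≤ l,
        ∏ i, ∏ j ∈ X i, a i * b j =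
      (of fun i k : Fin l => circleCoeff (symbol a b (range m) (range n)) ((k : ℤ) - i)).det := by
  classical
  have sum_eq_det :=
    (isCoeffFamily_circleCoeff_symbol ha b n).sum_respectsThreshold m (isThreshold_ite l n)
  have thresholdMatrix_eq : thresholdMatrix l
      (fun c => circleCoeff (symbol a b (range m) (Ico c n))) (fun k => if k < l then 0 else n) =
      of fun i k : Fin l => circleCoeff (symbol a b (range m) (range n)) ((k : ℤ) - i) := by
    ext i k
    simp only [thresholdMatrix, of_apply, k.isLt, if_true, range_eq_Ico]
  simp only [lastPassageTime_le_iff_respectsThreshold]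
  rw [← thresholdMatrix_eq, ← sum_eq_det]

theorem sum_lastPassageTime_le_eq_cueAverage {m n : ℕ} {a : Fin m → ℂ} (ha : ∀ i, ‖a i‖ < 1)
    (b : Fin n → ℂ) (l : ℕ) :
    ∑ X : Fin m → Finset (Fin n) with lastPassageTime (indicatorArray X) ≤ l,
        ∏ i, ∏ j ∈ X i, a i * b j =
      cueAverage l fun θ => ∏ k, symbol a b univ univ (Complex.exp (Complex.I * θ k)) := by
  let a' : ℕ → ℂ := Function.extend Fin.val a 0
  let b' : ℕ → ℂ := Function.extend Fin.val b 0
  have ha'_val (i : Fin m) : a' i = a i := Fin.val_injective.extend_apply a 0 i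
  have hb'_val (j : Fin n) : b' j = b j := Fin.val_injective.extend_apply b 0 j
  have ha' (i : ℕ) : ‖a' i‖ < 1 := by
    by_cases hi : ∃ i' : Fin m, (i' : ℕ) = i
    · obtain ⟨i', rfl⟩ := hi
      simpa only [ha'_val] using ha i'
    · simp only [a', Function.extend_apply' _ _ _ hi, Pi.zero_apply, norm_zero, zero_lt_one]
  have symbol_eq : symbol a b univ univ = symbol a' b' (range m) (range n) := by
    ext z
    simp only [symbol, prod_range, ha'_val, hb'_val]
  rw [cueAverage_prod_eq_det (continuousOn_symbol ha b univ univ), symbol_eq,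
    ← sum_lastPassageTime_le_eq_det ha']
  simp only [ha'_val, hb'_val]

end GeneratingFunction

section RandomArrays

open MeasureTheory ProbabilityTheory

variable {Ω : Type*} [MeasurableSpace Ω] {P : Measure Ω}

lemma measureReal_forall_eq {ι α : Type*} [Fintype ι] [MeasurableSpace α]
    [MeasurableSingletonClass α] {Y : ι → Ω → α} (hY : iIndepFun Y P) (y : ι → α) :
    P.real {ω | ∀ i, Y i ω = y i} = ∏ i, P.real {ω | Y i ω = y i} := by
  have meas_iInter := hY.meas_iInter (s := fun i => Y i ⁻¹' {y i})
    fun i => ⟨_, measurableSet_singleton _, rfl⟩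
  simp only [measureReal_def, ← ENNReal.toReal_prod, Set.ofPred_forall]
  exact congrArg ENNReal.toReal meas_iInter

lemma ae_eq_zero_or_one [IsProbabilityMeasure P] {Y : Ω → ℕ} (hY : Measurable Y)
    (hsum : P.real {ω | Y ω = 0} + P.real {ω | Y ω = 1} = 1) : ∀ᵐ ω ∂P, Y ω = 0 ∨ Y ω = 1 := by
  have hm (k : ℕ) : MeasurableSet {ω | Y ω = k} := hY (measurableSet_singleton k)
  have disjoint : Disjoint {ω | Y ω = 0} {ω | Y ω = 1} :=
    Set.disjoint_left.2 fun ω h0 h1 => by simp_all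
  rw [← measureReal_union disjoint (hm 1), measureReal_def, ENNReal.toReal_eq_one_iff] at hsum
  exact (prob_compl_eq_zero_iff ((hm 0).union (hm 1))).2 hsum

variable {ι κ : Type*} [Fintype ι] [Fintype κ] [DecidableEq ι] [DecidableEq κ] {x : ι → κ → Ω → ℕ}

lemma measureReal_eq_sum_indicatorArray [IsFiniteMeasure P] (hmeas : ∀ i j, Measurable (x i j))
    (h01 : ∀ᵐ ω ∂P, ∀ i j, x i j ω = 0 ∨ x i j ω = 1) (Q : (ι → κ → ℕ) → Prop)
    [DecidablePred Q] :
    P.real {ω | Q fun i j => x i j ω} =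
      ∑ X with Q (indicatorArray X), P.real {ω | ∀ i j, x i j ω = indicatorArray X i j} := by
  rw [← measureReal_biUnion_finset]
  · refine measureReal_congr (Filter.eventuallyEq_set.2 ?_)
    filter_upwards [h01] with ω hω
    obtain ⟨X, hX⟩ := exists_indicatorArray_eq hω
    simp [← funext_iff, ← hX, injective_indicatorArray.eq_iff]
  · intro X _ X' _ hne
    refine Set.disjoint_left.2 fun ω h h' => hne (injective_indicatorArray ?_)
    ext i j
    exact (h i j).symm.trans (h' i j)
  · intro X _
    simp only [Set.ofPred_forall]
    exact MeasurableSet.iInter fun i => MeasurableSet.iInter fun j =>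
      hmeas i j (measurableSet_singleton _)

theorem measureReal_eq_prod_mul_sum [IsProbabilityMeasure P] {w : ι → κ → ℝ}
    (hw : ∀ i j, 1 + w i j ≠ 0) (hmeas : ∀ i j, Measurable (x i j))
    (hindep : iIndepFun (fun p : ι × κ => x p.1 p.2) P)
    (hlaw : ∀ i j, ∀ k ∈ ({0, 1} : Set ℕ), P.real {ω | x i j ω = k} = w i j ^ k / (1 + w i j))
    (Q : (ι → κ → ℕ) → Prop) [DecidablePred Q] :
    P.real {ω | Q fun i j => x i j ω} =
      (∏ i, ∏ j, (1 + w i j)⁻¹) * ∑ X with Q (indicatorArray X), ∏ i, ∏ j ∈ X i, w i j := by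
  have h01 : ∀ᵐ ω ∂P, ∀ i j, x i j ω = 0 ∨ x i j ω = 1 := by
    simp only [ae_all_iff]
    refine fun i j => ae_eq_zero_or_one (hmeas i j) ?_
    rw [hlaw i j 0 (by simp), hlaw i j 1 (by simp)]
    have := hw i j
    field_simp
  have prob_eq (X : ι → Finset κ) : P.real {ω | ∀ i j, x i j ω = indicatorArray X i j} =
      (∏ i, ∏ j, (1 + w i j)⁻¹) * ∏ i, ∏ j ∈ X i, w i j := by
    have mem (i : ι) (j : κ) : indicatorArray X i j ∈ ({0, 1} : Set ℕ) := by
      simp [indicatorArray, em']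
    have forall_eq := measureReal_forall_eq hindep fun p => indicatorArray X p.1 p.2
    simp only [Prod.forall, Fintype.prod_prod_type, hlaw _ _ _ (mem _ _), div_eq_inv_mul,
      prod_mul_distrib, prod_pow_indicatorArray] at forall_eq
    exact forall_eq
  rw [measureReal_eq_sum_indicatorArray hmeas h01, mul_sum]
  exact sum_congr rfl fun X _ => prob_eq X

end RandomArrays

theorem mainTheorem5 {Ω : Type*} [MeasurableSpace Ω]
    (P : MeasureTheory.Measure Ω) [MeasureTheory.IsProbabilityMeasure P]
    (m n : ℕ) (a : Fin m → ℝ) (b : Fin n → ℝ)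
    (hab : ∀ i j, 0 ≤ a i * b j) (ha : ∀ i, |a i| < 1)
    (x : Fin m → Fin n → Ω → ℕ)
    (hmeas : ∀ i j, Measurable (x i j))
    (hindep : ProbabilityTheory.iIndepFun (fun p : Fin m × Fin n => x p.1 p.2) P)
    (hlaw : ∀ i j, ∀ k ∈ ({0, 1} : Set ℕ),
      P.real {ω | x i j ω = k} = (a i * b j) ^ k / (1 + a i * b j))
    (l : ℕ) :
    ((P.real {ω | lastPassageTime (fun i j => x i j ω) ≤ l} : ℝ) : ℂ) =
      ((∏ i, ∏ j, (1 + a i * b j)⁻¹ : ℝ) : ℂ) *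
        cueAverage l (fun θ =>
          (∏ j : Fin n, ∏ k : Fin l, (1 + (b j : ℂ) * Complex.exp (Complex.I * (θ k : ℂ)))) *
          (∏ i : Fin m, ∏ k : Fin l,
            (1 - (a i : ℂ) * Complex.exp (-(Complex.I * (θ k : ℂ)))))⁻¹) := by
  have one_add_ne_zero (i : Fin m) (j : Fin n) : 1 + a i * b j ≠ 0 :=
    (add_pos_of_pos_of_nonneg one_pos (hab i j)).ne'
  have norm_lt_one (i : Fin m) : ‖(a i : ℂ)‖ < 1 := by simpa using ha i
  simp only [Complex.exp_neg, ← prod_symbol]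
  rw [← sum_lastPassageTime_le_eq_cueAverage norm_lt_one,
    measureReal_eq_prod_mul_sum one_add_ne_zero hmeas hindep hlaw fun y => lastPassageTime y ≤ l,
    Complex.ofReal_mul]
  push_cast
  rfl
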